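/- Let $d\ge 2$, let $\mathcal X$ be the set of $d\times d$ density matrices (complex positive semidefinite matrices of trace one), let $\rho\in\mathcal X$ be a pure target state (a density matrix of rank one), and let $1-\epsilon\in(0.75,1)$. A measurement scheme consists of finitely many POVMs $\{E^{(l)}_1,\dots,E^{(l)}_{N_l}\}$, $l=1,\dots,L$, of $d\times d$ matrices, the $l$-th of which is measured $R_l$ times; $R=\sum_l R_l$ is its total number of shots. For a parameter $\epsilon_o\ge 0$ and $\chi\in\mathcal X$ put $p^{(l)}_\chi(k)=\frac{\operatorname{tr}(E^{(l)}_k\chi)+\epsilon_o/N_l}{1+\epsilon_o}$ (the Born probabilities when $\epsilon_o=0$). For $\chi_1,\chi_2\in\mathcal X$, $\phi=(\phi^{(l)}_k)$ a family of real numbers, and $\alpha>0$, let $$\Phi(\chi_1,\chi_2;\phi,\alpha)=\operatorname{tr}(\rho\chi_1)-\operatorname{tr}(\rho\chi_2)+2\alpha\ln\frac2\epsilon+\alpha\sum_{l=1}^L R_l\Big[\ln\sum_{k}e^{-\phi^{(l)}_k/\alpha}p^{(l)}_{\chi_1}(k)+\ln\sum_{k}e^{\phi^{(l)}_k/\alpha}p^{(l)}_{\chi_2}(k)\Big].$$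 The risk of the minimax method is half the saddle-point value of $\Phi$, $$\widehat{\mathcal R}_*=\tfrac12\sup_{\chi_1,\chi_2\in\mathcal X}\ \inf_{\phi,\ \alpha>0}\Phi=\tfrac12\inf_{\phi,\ \alpha>0}\ \sup_{\chi_1,\chi_2\in\mathcal X}\Phi .$$ Then the following hold. 1. For every measurement scheme and every $\epsilon_o\ge0$ the two expressions for $\widehat{\mathcal R}_*$ are finite and agree. 2. For every measurement scheme with $R\ge1$ and every $\epsilon_o\ge 0$, $$\widehat{\mathcal R}_*\ \ge\ \tfrac12\sqrt{1-(\epsilon/2)^{2/R}} .$$ 3. The bound is attained by measuring in the basis defined by $\rho$: for $R\ge1$ repetitions of the two-outcome POVM $\{\rho,\mathbb 1-\rho\}$ and $\epsilon_o=0$, $\widehat{\mathcal R}_*=\tfrac12\sqrt{1-(\epsilon/2)^{2/R}}$; for general $\epsilon_o\ge0$, $\widehat{\mathcal R}_*\le(1+\epsilon_o)\cdot\tfrac12\sqrt{1-(\epsilon/2)^{2/R}}$ for this scheme. 4. Let $r\in(0,0.5)$. For every $\epsilon_o\ge 0$, any measurement scheme whose risk satisfies $\widehat{\mathcal R}_*\le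 r$ has a total number of shots $$R\ \ge\ \frac{2\ln(2/\epsilon)}{|\ln(1-4r^2)|},$$ and conversely, for every integer $R$ satisfying this inequality, $R$ repetitions of $\{\rho,\mathbb 1-\rho\}$ with $\epsilon_o=0$ achieve $\widehat{\mathcal R}_*\le r$. Moreover, as $r\to0^+$, the right-hand side is asymptotically equivalent to $\dfrac{\ln(2/\epsilon)}{2r^2}$. -/

import Mathlib

noncomputable section

open scoped ComplexOrder

namespace QuantumMinimax

/-- Density matrices: complex positive semidefinite `d × d` matrices of unit trace. -/
def densityMatrices (d : ℕ) : Set (Matrix (Fin d) (Fin d) ℂ) :=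
  {χ | χ.PosSemidef ∧ χ.trace = 1}

/-- A pure state is a density matrix of rank one. -/
def IsPureState {d : ℕ} (ρ : Matrix (Fin d) (Fin d) ℂ) : Prop :=
  ρ ∈ densityMatrices d ∧ ρ.rank = 1

/-- The real number `tr (A χ)`; for a pure state `A` it is the fidelity of `A` and `χ`,
for a POVM element `A` it is the Born probability of that outcome in the state `χ`. -/
def expVal {d : ℕ} (A χ : Matrix (Fin d) (Fin d) ℂ) : ℝ :=
  (A * χ).trace.re

/-- A measurement scheme: `L` measurement settings; the setting `l` is the POVM
`E l 0, …, E l (N l - 1)` (positive semidefinite matrices that sum to the identity),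
which is measured `R l` times. -/
structure MeasurementScheme (d : ℕ) where
  L : ℕ
  N : Fin L → ℕ
  E : (l : Fin L) → Fin (N l) → Matrix (Fin d) (Fin d) ℂ
  posSemidef : ∀ l k, (E l k).PosSemidef
  sum_eq_one : ∀ l, ∑ k, E l k = 1
  R : Fin L → ℕ

namespace MeasurementScheme

variable {d : ℕ}

/-- The total number of shots, all measurement settings combined. -/
def totalShots (M : MeasurementScheme d) : ℕ := ∑ l, M.R l

/-- The outcome probabilities `(tr (E l k χ) + ε₀ / N l) / (1 + ε₀)`;
for `ε₀ = 0` these are the Born probabilities. -/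
def prob (M : MeasurementScheme d) (ε₀ : ℝ) (χ : Matrix (Fin d) (Fin d) ℂ)
    (l : Fin M.L) (k : Fin (M.N l)) : ℝ :=
  (expVal (M.E l k) χ + ε₀ / M.N l) / (1 + ε₀)

/-- Affine estimators: a real function on the outcomes of each measurement setting. -/
abbrev AffineEstimator (M : MeasurementScheme d) : Type :=
  (l : Fin M.L) → Fin (M.N l) → ℝ

/-- The function `Φ(χ₁, χ₂; φ, α)` of the minimax method. -/
def Phi (M : MeasurementScheme d) (ρ : Matrix (Fin d) (Fin d) ℂ) (ε ε₀ : ℝ)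
    (χ₁ χ₂ : Matrix (Fin d) (Fin d) ℂ) (φ : M.AffineEstimator) (α : ℝ) : ℝ :=
  expVal ρ χ₁ - expVal ρ χ₂ + 2 * α * Real.log (2 / ε)
    + α * ∑ l, (M.R l : ℝ) *
      (Real.log (∑ k, Real.exp (-(φ l k) / α) * M.prob ε₀ χ₁ l k)
        + Real.log (∑ k, Real.exp (φ l k / α) * M.prob ε₀ χ₂ l k))

/-- The sup-inf value of `Φ`, with `χ₁, χ₂` ranging over the density matrices, `φ` over the affine
estimators and `α` over the positive reals. -/
def supInfPhi (M : MeasurementScheme d) (ρ : Matrix (Fin d) (Fin d) ℂ) (ε ε₀ : ℝ) : EReal :=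
  ⨆ χ ∈ densityMatrices d ×ˢ densityMatrices d,
    ⨅ ψ ∈ (Set.univ : Set M.AffineEstimator) ×ˢ Set.Ioi (0 : ℝ),
      ((M.Phi ρ ε ε₀ χ.1 χ.2 ψ.1 ψ.2 : ℝ) : EReal)

/-- The inf-sup value of `Φ`. -/
def infSupPhi (M : MeasurementScheme d) (ρ : Matrix (Fin d) (Fin d) ℂ) (ε ε₀ : ℝ) : EReal :=
  ⨅ ψ ∈ (Set.univ : Set M.AffineEstimator) ×ˢ Set.Ioi (0 : ℝ),
    ⨆ χ ∈ densityMatrices d ×ˢ densityMatrices d,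
      ((M.Phi ρ ε ε₀ χ.1 χ.2 ψ.1 ψ.2 : ℝ) : EReal)

/-- The risk computed by the minimax method for the target state `ρ`, the confidence level `1 - ε`
and the measurement scheme `M`: half the saddle-point value of `Φ`. -/
def minimaxRisk (M : MeasurementScheme d) (ρ : Matrix (Fin d) (Fin d) ℂ) (ε ε₀ : ℝ) : ℝ :=
  (1 / 2) * (M.supInfPhi ρ ε ε₀).toReal

end MeasurementScheme

theorem posSemidef_one_sub {d : ℕ} {ρ : Matrix (Fin d) (Fin d) ℂ}
    (hρ : ρ ∈ densityMatrices d) : (1 - ρ).PosSemidef := by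
  obtain ⟨hp, ht⟩ := hρ
  have hH := hp.isHermitian
  have hsum : ∑ i, hH.eigenvalues i = 1 := by
    have h := hH.trace_eq_sum_eigenvalues
    rw [ht] at h
    have h' := congrArg Complex.re h
    simpa using h'.symm
  have hle : ∀ i, hH.eigenvalues i ≤ 1 := fun i => by
    rw [← hsum]
    exact Finset.single_le_sum (fun j _ => hp.eigenvalues_nonneg j) (Finset.mem_univ i)
  have hD : (Matrix.diagonal (fun i => ((1 - hH.eigenvalues i : ℝ) : ℂ))).PosSemidef := by
    rw [Matrix.posSemidef_diagonal_iff]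
    intro i
    exact_mod_cast sub_nonneg.mpr (hle i)
  have hU : (hH.eigenvectorUnitary : Matrix (Fin d) (Fin d) ℂ)
      * star (hH.eigenvectorUnitary : Matrix (Fin d) (Fin d) ℂ) = 1 :=
    Unitary.coe_mul_star_self hH.eigenvectorUnitary
  have key : 1 - ρ = (hH.eigenvectorUnitary : Matrix (Fin d) (Fin d) ℂ)
      * Matrix.diagonal (fun i => ((1 - hH.eigenvalues i : ℝ) : ℂ))
      * (hH.eigenvectorUnitary : Matrix (Fin d) (Fin d) ℂ).conjTranspose := by
    have hs := hH.spectral_theorem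
    rw [Unitary.conjStarAlgAut_apply] at hs
    have hd : Matrix.diagonal (fun i => ((1 - hH.eigenvalues i : ℝ) : ℂ))
        = 1 - Matrix.diagonal ((RCLike.ofReal : ℝ → ℂ) ∘ hH.eigenvalues) := by
      rw [← Matrix.diagonal_one, Matrix.diagonal_sub]
      congr 1
      funext i
      simp
    rw [hd, Matrix.mul_sub, Matrix.sub_mul, Matrix.mul_one, ← Matrix.star_eq_conjTranspose, hU]
    congr 1
  rw [key]
  exact hD.mul_mul_conjTranspose_same _

/-- The scheme that measures the single two-outcome POVM `{ρ, 1 - ρ}`, with `R` repetitions. -/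
def targetScheme {d : ℕ} (ρ : Matrix (Fin d) (Fin d) ℂ) (hρ : ρ ∈ densityMatrices d) (R : ℕ) :
    MeasurementScheme d where
  L := 1
  N := fun _ => 2
  E := fun _ => ![ρ, 1 - ρ]
  posSemidef := fun _ k => by
    fin_cases k
    · exact hρ.1
    · exact posSemidef_one_sub hρ
  sum_eq_one := fun _ => by
    simp [Fin.sum_univ_two]
  R := fun _ => R

end QuantumMinimax

end

/-! `Φ` is concave in the states, being built from logarithms of affine functions, and jointly
convex in `(φ, α)`, being built from perspectives of log-sum-exp. The states form a compact convex
set, so Sion's theorem gives the saddle value (`supInfPhi_eq_infSupPhi`). Hence any pair of states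
certifies a lower bound on the risk and any pair `(φ, α)` an upper bound.

Put `γ = (ε/2)^(1/R)` and `s = √(1 - γ²)`. By Cauchy-Schwarz, two states whose outcome distributions
have overlap at least `γ` in every setting satisfy `Φ ≥ tr(ρχ₁) - tr(ρχ₂)`: the logarithms
contribute at least `2αR log γ`, which cancels `2α log(2/ε)` (`le_Phi_of_overlap`). For `σ`
orthogonal to `ρ`, the mixtures of `ρ` and `σ` with weights `(1 ± s)/2` have this overlap under
every POVM, and their fidelities differ by `s`.

For `{ρ, 1 - ρ}` an explicit estimator matches this: bounding each logarithm by its tangent at `γ`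
makes the dependence on the states cancel (`sub_add_log_add_log_le`). Solving the resulting formula
for `R` gives the sample complexity (`half_sqrt_le_iff`). -/

namespace QuantumMinimax

open scoped ComplexOrder

/-! ### Density matrices: compactness, convexity, pure states -/

section States

variable {d : ℕ} {A ρ χ χ' : Matrix (Fin d) (Fin d) ℂ}

open scoped MatrixOrder in
theorem expVal_nonneg (hA : A.PosSemidef) (hχ : χ.PosSemidef) : 0 ≤ expVal A χ := by
  obtain ⟨B, rfl⟩ := CStarAlgebra.nonneg_iff_eq_star_mul_self.mp hA.nonneg
  have h : (star B * B * χ).trace = (B * χ * B.conjTranspose).trace := by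
    rw [Matrix.star_eq_conjTranspose, Matrix.mul_assoc, Matrix.trace_mul_comm]
  rw [expVal, h]
  exact (Complex.le_def.mp (hχ.mul_mul_conjTranspose_same B).trace_nonneg).1

theorem expVal_one_left (hχ : χ ∈ densityMatrices d) : expVal 1 χ = 1 := by
  simp [expVal, hχ.2]

theorem expVal_sub_left (A B χ : Matrix (Fin d) (Fin d) ℂ) :
    expVal (A - B) χ = expVal A χ - expVal B χ := by
  simp [expVal, sub_mul]

theorem expVal_sum_left {ι : Type*} (s : Finset ι) (E : ι → Matrix (Fin d) (Fin d) ℂ)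
    (χ : Matrix (Fin d) (Fin d) ℂ) : expVal (∑ k ∈ s, E k) χ = ∑ k ∈ s, expVal (E k) χ := by
  simp [expVal, Finset.sum_mul, Matrix.trace_sum]

theorem expVal_smul_add_smul (A χ χ' : Matrix (Fin d) (Fin d) ℂ) (a b : ℝ) :
    expVal A (a • χ + b • χ') = a * expVal A χ + b * expVal A χ' := by
  simp [expVal, mul_add]

theorem continuous_expVal (A : Matrix (Fin d) (Fin d) ℂ) : Continuous (expVal A) := by
  unfold expVal
  fun_prop

theorem expVal_le_one (hρ : ρ ∈ densityMatrices d) (hχ : χ ∈ densityMatrices d) :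
    expVal ρ χ ≤ 1 := by
  have h := expVal_nonneg (posSemidef_one_sub hρ) hχ.1
  rw [expVal_sub_left, expVal_one_left hχ] at h
  linarith

theorem convex_densityMatrices (d : ℕ) : Convex ℝ (densityMatrices d) := by
  intro χ hχ χ' hχ' a b ha hb hab
  refine ⟨(hχ.1.smul ha).add (hχ'.1.smul hb), ?_⟩
  rw [Matrix.trace_add, Matrix.trace_smul, Matrix.trace_smul, hχ.2, hχ'.2, ← add_smul, hab,
    one_smul]

theorem isClosed_densityMatrices (d : ℕ) : IsClosed (densityMatrices d) := by
  have h : densityMatrices d = {χ | χ.conjTranspose = χ} ∩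
      (⋂ x : Fin d → ℂ, {χ | 0 ≤ star x ⬝ᵥ (χ.mulVec x)}) ∩ {χ | χ.trace = 1} := by
    ext χ
    simp [densityMatrices, Matrix.posSemidef_iff_dotProduct_mulVec, Matrix.IsHermitian]
  rw [h]
  refine (IsClosed.inter ?_ (isClosed_iInter fun x => ?_)).inter ?_
  · exact isClosed_eq (by fun_prop) (by fun_prop)
  · exact isClosed_le (by fun_prop) (by fun_prop)
  · exact isClosed_eq (by fun_prop) (by fun_prop)

/-- `tr χ²` is the sum of all squared moduli of entries, and it is at most `tr χ = 1`. This gives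
the boundedness needed for compactness. -/
theorem norm_apply_le_one (hχ : χ ∈ densityMatrices d) (i j : Fin d) : ‖χ i j‖ ≤ 1 := by
  have h := expVal_le_one hχ hχ
  have hsum : expVal χ χ = ∑ i, ∑ j, ‖χ i j‖ ^ 2 := by
    rw [expVal, Matrix.trace, Complex.re_sum]
    refine Finset.sum_congr rfl fun i _ => ?_
    rw [Matrix.diag_apply, Matrix.mul_apply, Complex.re_sum]
    refine Finset.sum_congr rfl fun j _ => ?_
    rw [← hχ.1.isHermitian.apply j i, Complex.star_def, Complex.mul_conj, Complex.ofReal_re,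
      Complex.normSq_eq_norm_sq]
  have hij : ‖χ i j‖ ^ 2 ≤ 1 := calc
    ‖χ i j‖ ^ 2 ≤ ∑ j, ‖χ i j‖ ^ 2 :=
      Finset.single_le_sum (f := fun j => ‖χ i j‖ ^ 2) (fun _ _ => by positivity)
        (Finset.mem_univ j)
    _ ≤ ∑ i, ∑ j, ‖χ i j‖ ^ 2 :=
      Finset.single_le_sum (f := fun i => ∑ j, ‖χ i j‖ ^ 2) (fun _ _ => by positivity)
        (Finset.mem_univ i)
    _ ≤ 1 := hsum ▸ h
  exact (sq_le_one_iff₀ (norm_nonneg _)).mp hij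

theorem isCompact_densityMatrices (d : ℕ) : IsCompact (densityMatrices d) := by
  have hK : IsCompact (Set.univ.pi fun _ : Fin d => Set.univ.pi fun _ : Fin d =>
      Metric.closedBall (0 : ℂ) 1) :=
    isCompact_univ_pi fun _ => isCompact_univ_pi fun _ => isCompact_closedBall 0 1
  refine hK.of_isClosed_subset (isClosed_densityMatrices d) fun χ hχ i _ j _ => ?_
  simpa using norm_apply_le_one hχ i j

/-- All columns are multiples of one vector, so `A = v cᵀ` and `A² = (c ⬝ v) A`, where `c ⬝ v` is
the trace. -/
theorem _root_.Matrix.mul_self_eq_trace_smul_of_rank_eq_one {K n : Type*} [Field K] [Fintype n]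
    {A : Matrix n n K} (hA : A.rank = 1) : A * A = A.trace • A := by
  classical
  obtain ⟨v, -, hv⟩ := finrank_eq_one_iff'.mp hA
  choose c hc using fun j => hv ⟨A.mulVecLin (Pi.single j 1), LinearMap.mem_range_self _ _⟩
  have hA' : ∀ i j, A i j = c j * v.1 i := fun i j => by
    have h := congrFun (congrArg Subtype.val (hc j)) i
    simpa using h.symm
  ext i j
  simp only [Matrix.mul_apply, Matrix.trace, Matrix.smul_apply, Matrix.diag_apply, hA',
    smul_eq_mul, Finset.sum_mul]
  exact Finset.sum_congr rfl fun k _ => by ring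

theorem IsPureState.mul_self (hρ : IsPureState ρ) : ρ * ρ = ρ := by
  rw [Matrix.mul_self_eq_trace_smul_of_rank_eq_one hρ.2, hρ.1.2, one_smul]

theorem IsPureState.expVal_self (hρ : IsPureState ρ) : expVal ρ ρ = 1 := by
  rw [expVal, hρ.mul_self, hρ.1.2, Complex.one_re]

/-- The witness is the normalised complement `(1 - ρ)/(d - 1)`; this is where `d ≥ 2` enters. -/
theorem IsPureState.exists_orthogonal (hd : 2 ≤ d) (hρ : IsPureState ρ) :
    ∃ σ ∈ densityMatrices d, expVal ρ σ = 0 := by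
  have hd' : (0 : ℝ) < d - 1 := by
    have : (2 : ℝ) ≤ d := by exact_mod_cast hd
    linarith
  refine ⟨((d : ℝ) - 1)⁻¹ • (1 - ρ),
    ⟨(posSemidef_one_sub hρ.1).smul (inv_nonneg.mpr hd'.le), ?_⟩, ?_⟩
  · rw [Matrix.trace_smul, Matrix.trace_sub, Matrix.trace_one, hρ.1.2, Fintype.card_fin]
    have : ((d : ℂ) - 1) = (((d : ℝ) - 1 : ℝ) : ℂ) := by push_cast; rfl
    rw [this, Complex.real_smul, ← Complex.ofReal_mul, inv_mul_cancel₀ hd'.ne', Complex.ofReal_one]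
  · simp [expVal, mul_sub, hρ.mul_self]

end States


/-! ### Convexity and Cauchy-Schwarz for log-sum-exp -/

section RealInequalities

variable {ι : Type*} {s : Finset ι}

theorem sum_exp_mul_pos {p : ι → ℝ} (hp : ∀ k ∈ s, 0 ≤ p k) (hs : ∑ k ∈ s, p k = 1) (u : ι → ℝ) :
    0 < ∑ k ∈ s, Real.exp (u k) * p k := by
  obtain ⟨k, hk, hpk⟩ : ∃ k ∈ s, 0 < p k :=
    Finset.exists_lt_of_sum_lt (by simp [hs])
  exact Finset.sum_pos' (fun i hi => mul_nonneg (Real.exp_pos _).le (hp i hi))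
    ⟨k, hk, mul_pos (Real.exp_pos _) hpk⟩

/-- The log-moment-generating functional is convex in the exponent. -/
theorem log_sum_exp_convex {p : ι → ℝ} (hp : ∀ k ∈ s, 0 ≤ p k) (hs : ∑ k ∈ s, p k = 1)
    (u v : ι → ℝ) {a b : ℝ} (ha : 0 ≤ a) (hb : 0 ≤ b) (hab : a + b = 1) :
    Real.log (∑ k ∈ s, Real.exp (a * u k + b * v k) * p k)
      ≤ a * Real.log (∑ k ∈ s, Real.exp (u k) * p k)
        + b * Real.log (∑ k ∈ s, Real.exp (v k) * p k) := by
  set U := ∑ k ∈ s, Real.exp (u k) * p k with hU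
  set V := ∑ k ∈ s, Real.exp (v k) * p k with hV
  have hUpos : 0 < U := sum_exp_mul_pos hp hs u
  have hVpos : 0 < V := sum_exp_mul_pos hp hs v
  rw [Real.log_le_iff_le_exp (sum_exp_mul_pos hp hs _)]
  set c := a * Real.log U + b * Real.log V with hc
  -- Hölder's inequality termwise: normalise both sums to one by subtracting `log U` and `log V`
  -- from the exponents, then use convexity of `exp`.
  have hterm : ∀ k ∈ s, Real.exp (a * u k + b * v k) * p k ≤
      Real.exp c * (a * (Real.exp (u k) * p k / U) + b * (Real.exp (v k) * p k / V)) := by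
    intro k hk
    have hconv := convexOn_exp.2 (Set.mem_univ (u k - Real.log U))
      (Set.mem_univ (v k - Real.log V)) ha hb hab
    simp only [smul_eq_mul, Real.exp_sub, Real.exp_log hUpos, Real.exp_log hVpos] at hconv
    have hexp : Real.exp (a * u k + b * v k)
        = Real.exp c * Real.exp (a * (u k - Real.log U) + b * (v k - Real.log V)) := by
      rw [← Real.exp_add, hc]
      ring_nf
    calc Real.exp (a * u k + b * v k) * p k
        ≤ Real.exp c * (a * (Real.exp (u k) / U) + b * (Real.exp (v k) / V)) * p k := by
          rw [hexp]
          gcongr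
          exact hp k hk
      _ = _ := by ring
  refine (Finset.sum_le_sum hterm).trans_eq ?_
  rw [← Finset.mul_sum, Finset.sum_add_distrib, ← Finset.mul_sum, ← Finset.mul_sum,
    ← Finset.sum_div, ← Finset.sum_div, ← hU, ← hV, div_self hUpos.ne', div_self hVpos.ne',
    mul_one, mul_one, hab, mul_one]

/-- Convexity of the perspective function of the log-moment-generating functional. -/
theorem perspective_log_sum_exp_convex {p : ι → ℝ} (hp : ∀ k ∈ s, 0 ≤ p k)
    (hs : ∑ k ∈ s, p k = 1) (u v : ι → ℝ) {a b α β : ℝ} (ha : 0 ≤ a) (hb : 0 ≤ b)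
    (hab : a + b = 1) (hα : 0 < α) (hβ : 0 < β) :
    (a * α + b * β) *
        Real.log (∑ k ∈ s, Real.exp ((a * u k + b * v k) / (a * α + b * β)) * p k)
      ≤ a * (α * Real.log (∑ k ∈ s, Real.exp (u k / α) * p k))
        + b * (β * Real.log (∑ k ∈ s, Real.exp (v k / β) * p k)) := by
  have hγ : 0 < a * α + b * β := by
    rcases ha.eq_or_lt with rfl | ha'
    · simp_all
    · have := mul_pos ha' hα
      have := mul_nonneg hb hβ.le
      linarith
  set γ := a * α + b * β with hγ_def
  -- Dividing by `γ` reweights the two points by `aα/γ` and `bβ/γ`, which again sum to one.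
  have h := log_sum_exp_convex hp hs (fun k => u k / α) (fun k => v k / β)
    (a := a * α / γ) (b := b * β / γ) (by positivity) (by positivity)
    (by rw [← add_div, ← hγ_def, div_self hγ.ne'])
  have hexp : ∀ k, a * α / γ * (u k / α) + b * β / γ * (v k / β) = (a * u k + b * v k) / γ := by
    intro k
    field_simp
  simp only [hexp] at h
  refine (mul_le_mul_of_nonneg_left h hγ.le).trans_eq ?_
  field_simp

/-- Cauchy-Schwarz for a pair of exponentially tilted sums. -/
theorem two_mul_log_le_of_sq_le_mul {p q r : ι → ℝ} (hp : ∀ k ∈ s, 0 ≤ p k)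
    (hq : ∀ k ∈ s, 0 ≤ q k) (hr : ∀ k ∈ s, r k ^ 2 ≤ p k * q k) (hpos : 0 < ∑ k ∈ s, r k)
    (hps : ∑ k ∈ s, p k = 1) (hqs : ∑ k ∈ s, q k = 1) (u : ι → ℝ) :
    2 * Real.log (∑ k ∈ s, r k) ≤
      Real.log (∑ k ∈ s, Real.exp (-u k) * p k) + Real.log (∑ k ∈ s, Real.exp (u k) * q k) := by
  have hP := sum_exp_mul_pos hp hps (fun k => -u k)
  have hQ := sum_exp_mul_pos hq hqs u
  have h : (∑ k ∈ s, r k) ^ 2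
      ≤ (∑ k ∈ s, Real.exp (-u k) * p k) * ∑ k ∈ s, Real.exp (u k) * q k := by
    refine Finset.sum_sq_le_sum_mul_sum_of_sq_le_mul s
      (fun k hk => mul_nonneg (Real.exp_pos _).le (hp k hk))
      (fun k hk => mul_nonneg (Real.exp_pos _).le (hq k hk)) fun k hk => ?_
    calc r k ^ 2 ≤ p k * q k := hr k hk
      _ = Real.exp (-u k) * Real.exp (u k) * (p k * q k) := by
        rw [← Real.exp_add, neg_add_cancel, Real.exp_zero, one_mul]
      _ = _ := by ring
  rw [← Real.log_mul hP.ne' hQ.ne']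
  calc 2 * Real.log (∑ k ∈ s, r k) = Real.log ((∑ k ∈ s, r k) ^ 2) := by
        rw [Real.log_pow]; norm_num
    _ ≤ _ := Real.log_le_log (by positivity) h

theorem sum_mul_add_add (s : Finset ι) (w A A' B B' : ι → ℝ) (a b : ℝ) :
    ∑ l ∈ s, w l * ((a * A l + b * A' l) + (a * B l + b * B' l))
      = a * ∑ l ∈ s, w l * (A l + B l) + b * ∑ l ∈ s, w l * (A' l + B' l) := by
  rw [Finset.mul_sum, Finset.mul_sum, ← Finset.sum_add_distrib]
  exact Finset.sum_congr rfl fun l _ => by ring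

end RealInequalities

/-! ### Minimax theorem and saddle point of `Φ` -/

open Set in
/-- Sion's minimax theorem for real functions, in sup-inf form with the compact set on the
maximizing side. -/
theorem iSup_iInf_eq_iInf_iSup_of_concave_convex {E F : Type*}
    [TopologicalSpace E] [AddCommGroup E] [Module ℝ E] [IsTopologicalAddGroup E]
    [ContinuousSMul ℝ E] [TopologicalSpace F] [AddCommGroup F] [Module ℝ F]
    [IsTopologicalAddGroup F] [ContinuousSMul ℝ F] {X : Set E} {Y : Set F} {f : E → F → ℝ}
    (ne_X : X.Nonempty) (kX : IsCompact X)
    (hX : ∀ y ∈ Y, ContinuousOn (fun x => f x y) X) (hX' : ∀ y ∈ Y, ConcaveOn ℝ X fun x => f x y)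
    (cX : Convex ℝ X) (cY : Convex ℝ Y)
    (hY : ∀ x ∈ X, ContinuousOn (f x) Y) (hY' : ∀ x ∈ X, ConvexOn ℝ Y (f x)) :
    (⨆ x ∈ X, ⨅ y ∈ Y, (f x y : EReal)) = ⨅ y ∈ Y, ⨆ x ∈ X, (f x y : EReal) := by
  -- Passing to the order dual of `EReal` swaps suprema and infima, which puts the compact set on
  -- the maximizing side.
  refine Sion.minimax' (X := X) (Y := Y) (β := ERealᵒᵈ)
    (f := fun x y => OrderDual.toDual (f x y : EReal)) ne_X cX kX ?_ ?_ cY ?_ ?_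
  · intro y hy
    exact (continuous_coe_real_ereal.comp_continuousOn (hX y hy)).upperSemicontinuousOn
  · intro y hy
    exact ((hX' y hy).quasiconcaveOn.monotone_comp EReal.coe_strictMono.monotone).dual
  · intro x hx
    exact (continuous_coe_real_ereal.comp_continuousOn (hY x hx)).lowerSemicontinuousOn
  · intro x hx
    exact ((hY' x hx).quasiconvexOn.monotone_comp EReal.coe_strictMono.monotone).dual

namespace MeasurementScheme

variable {d : ℕ} (M : MeasurementScheme d) {ρ χ : Matrix (Fin d) (Fin d) ℂ} {ε ε₀ : ℝ}

/-- An empty POVM would sum to zero, not to the identity. Hence `ε₀ / N l` is a genuine division and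
the probabilities sum to one. -/
theorem N_pos (hd : 0 < d) (l : Fin M.L) : 0 < M.N l := by
  rcases Nat.eq_zero_or_pos (M.N l) with h | h
  · have h1 := M.sum_eq_one l
    have : IsEmpty (Fin (M.N l)) := by rw [h]; infer_instance
    rw [Finset.univ_eq_empty, Finset.sum_empty] at h1
    simpa using congrFun (congrFun h1 ⟨0, hd⟩) ⟨0, hd⟩
  · exact h

theorem prob_nonneg (h₀ : 0 ≤ ε₀) (hχ : χ ∈ densityMatrices d) (l : Fin M.L) (k : Fin (M.N l)) :
    0 ≤ M.prob ε₀ χ l k := by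
  have := expVal_nonneg (M.posSemidef l k) hχ.1
  unfold prob
  positivity

theorem sum_prob (hd : 0 < d) (h₀ : 0 ≤ ε₀) (hχ : χ ∈ densityMatrices d) (l : Fin M.L) :
    ∑ k, M.prob ε₀ χ l k = 1 := by
  have hN : (M.N l : ℝ) ≠ 0 := by exact_mod_cast (M.N_pos hd l).ne'
  unfold prob
  rw [← Finset.sum_div, Finset.sum_add_distrib, ← expVal_sum_left, M.sum_eq_one,
    expVal_one_left hχ, Finset.sum_const, Finset.card_univ, Fintype.card_fin, nsmul_eq_mul,
    mul_div_cancel₀ _ hN, div_self (by positivity)]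

theorem prob_smul_add_smul (χ χ' : Matrix (Fin d) (Fin d) ℂ) {a b : ℝ} (hab : a + b = 1)
    (l : Fin M.L) (k : Fin (M.N l)) :
    M.prob ε₀ (a • χ + b • χ') l k = a * M.prob ε₀ χ l k + b * M.prob ε₀ χ' l k := by
  unfold prob
  rw [expVal_smul_add_smul]
  calc _ = (a * expVal (M.E l k) χ + b * expVal (M.E l k) χ' + (a + b) * (ε₀ / M.N l)) / (1 + ε₀) := by
        rw [hab, one_mul]
    _ = _ := by ring

theorem continuous_prob (l : Fin M.L) (k : Fin (M.N l)) :
    Continuous fun χ => M.prob ε₀ χ l k := by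
  have := continuous_expVal (M.E l k)
  unfold prob
  fun_prop

theorem sum_exp_mul_prob_pos (hd : 0 < d) (h₀ : 0 ≤ ε₀) (hχ : χ ∈ densityMatrices d)
    (l : Fin M.L) (u : Fin (M.N l) → ℝ) : 0 < ∑ k, Real.exp (u k) * M.prob ε₀ χ l k :=
  sum_exp_mul_pos (fun k _ => M.prob_nonneg h₀ hχ l k) (M.sum_prob hd h₀ hχ l) u

theorem log_sum_exp_mul_prob_concave (hd : 0 < d) (h₀ : 0 ≤ ε₀) {χ χ' : Matrix (Fin d) (Fin d) ℂ}
    (hχ : χ ∈ densityMatrices d) (hχ' : χ' ∈ densityMatrices d) {a b : ℝ} (ha : 0 ≤ a) (hb : 0 ≤ b)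
    (hab : a + b = 1) (l : Fin M.L) (u : Fin (M.N l) → ℝ) :
    a * Real.log (∑ k, Real.exp (u k) * M.prob ε₀ χ l k)
        + b * Real.log (∑ k, Real.exp (u k) * M.prob ε₀ χ' l k)
      ≤ Real.log (∑ k, Real.exp (u k) * M.prob ε₀ (a • χ + b • χ') l k) := by
  have h := strictConcaveOn_log_Ioi.concaveOn.2
    (Set.mem_Ioi.mpr (M.sum_exp_mul_prob_pos hd h₀ hχ l u))
    (Set.mem_Ioi.mpr (M.sum_exp_mul_prob_pos hd h₀ hχ' l u)) ha hb hab
  simp only [smul_eq_mul] at h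
  refine h.trans_eq (congrArg Real.log ?_)
  rw [Finset.mul_sum, Finset.mul_sum, ← Finset.sum_add_distrib]
  refine Finset.sum_congr rfl fun k _ => ?_
  rw [M.prob_smul_add_smul _ _ hab]
  ring

theorem concaveOn_Phi (hd : 0 < d) (h₀ : 0 ≤ ε₀) (φ : M.AffineEstimator) {α : ℝ} (hα : 0 < α) :
    ConcaveOn ℝ (densityMatrices d ×ˢ densityMatrices d)
      fun χ => M.Phi ρ ε ε₀ χ.1 χ.2 φ α := by
  refine ⟨(convex_densityMatrices d).prod (convex_densityMatrices d), ?_⟩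
  rintro ⟨χ₁, χ₂⟩ ⟨h₁, h₂⟩ ⟨χ₁', χ₂'⟩ ⟨h₁', h₂'⟩ a b ha hb hab
  simp only at h₁ h₂ h₁' h₂'
  simp only [Phi, Prod.smul_mk, Prod.mk_add_mk, smul_eq_mul, expVal_smul_add_smul]
  have hsum := Finset.sum_le_sum fun (l : Fin M.L) (_ : l ∈ Finset.univ) =>
    mul_le_mul_of_nonneg_left (add_le_add
      (M.log_sum_exp_mul_prob_concave hd h₀ h₁ h₁' ha hb hab l fun k => -(φ l k) / α)
      (M.log_sum_exp_mul_prob_concave hd h₀ h₂ h₂' ha hb hab l fun k => φ l k / α))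
      (Nat.cast_nonneg (α := ℝ) (M.R l))
  rw [sum_mul_add_add] at hsum
  have hsum' := mul_le_mul_of_nonneg_left hsum hα.le
  obtain rfl : b = 1 - a := by linarith
  refine le_trans (le_of_eq ?_) (add_le_add_right hsum' _)
  ring

theorem convexOn_Phi (hd : 0 < d) (h₀ : 0 ≤ ε₀) {χ₁ χ₂ : Matrix (Fin d) (Fin d) ℂ}
    (h₁ : χ₁ ∈ densityMatrices d) (h₂ : χ₂ ∈ densityMatrices d) :
    ConvexOn ℝ ((Set.univ : Set M.AffineEstimator) ×ˢ Set.Ioi (0 : ℝ))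
      fun ψ => M.Phi ρ ε ε₀ χ₁ χ₂ ψ.1 ψ.2 := by
  refine ⟨convex_univ.prod (convex_Ioi 0), ?_⟩
  rintro ⟨φ, α⟩ ⟨-, hα⟩ ⟨φ', α'⟩ ⟨-, hα'⟩ a b ha hb hab
  simp only [Set.mem_Ioi] at hα hα'
  simp only [Phi, Prod.smul_mk, Prod.mk_add_mk, smul_eq_mul, Pi.add_apply, Pi.smul_apply]
  have hsum := Finset.sum_le_sum fun (l : Fin M.L) (_ : l ∈ Finset.univ) =>
    mul_le_mul_of_nonneg_left (add_le_add
      (perspective_log_sum_exp_convex (fun k _ => M.prob_nonneg h₀ h₁ l k) (M.sum_prob hd h₀ h₁ l)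
        (fun k => -(φ l k)) (fun k => -(φ' l k)) ha hb hab hα hα')
      (perspective_log_sum_exp_convex (fun k _ => M.prob_nonneg h₀ h₂ l k) (M.sum_prob hd h₀ h₂ l)
        (φ l) (φ' l) ha hb hab hα hα'))
      (Nat.cast_nonneg (α := ℝ) (M.R l))
  have hneg : ∀ l k, -(a * φ l k + b * φ' l k) = a * -φ l k + b * -φ' l k := fun l k => by ring
  simp only [hneg]
  rw [sum_mul_add_add] at hsum
  simp only [← mul_add, mul_left_comm _ (a * α + b * α'), mul_left_comm _ α, mul_left_comm _ α',
    ← Finset.mul_sum] at hsum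
  obtain rfl : b = 1 - a := by linarith
  refine (add_le_add_right hsum _).trans_eq ?_
  ring

theorem continuousOn_Phi_states (hd : 0 < d) (h₀ : 0 ≤ ε₀) (φ : M.AffineEstimator) (α : ℝ) :
    ContinuousOn (fun χ : Matrix (Fin d) (Fin d) ℂ × Matrix (Fin d) (Fin d) ℂ =>
      M.Phi ρ ε ε₀ χ.1 χ.2 φ α) (densityMatrices d ×ˢ densityMatrices d) := by
  have hρ := continuous_expVal ρ
  have hlog (l : Fin M.L) (u : Fin (M.N l) → ℝ) :
      ContinuousOn (fun χ => Real.log (∑ k, Real.exp (u k) * M.prob ε₀ χ l k))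
        (densityMatrices d) := by
    have hp := fun k => M.continuous_prob (ε₀ := ε₀) l k
    exact ContinuousOn.log (by fun_prop) fun χ hχ => (M.sum_exp_mul_prob_pos hd h₀ hχ l u).ne'
  unfold Phi
  refine ContinuousOn.add (by fun_prop) (continuousOn_const.mul (continuousOn_finsetSum _
    fun l _ => continuousOn_const.mul (ContinuousOn.add ?_ ?_)))
  · exact (hlog l fun k => -(φ l k) / α).comp continuousOn_fst fun χ hχ => hχ.1
  · exact (hlog l fun k => φ l k / α).comp continuousOn_snd fun χ hχ => hχ.2

theorem continuousOn_Phi_estimators (hd : 0 < d) (h₀ : 0 ≤ ε₀) {χ₁ χ₂ : Matrix (Fin d) (Fin d) ℂ}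
    (h₁ : χ₁ ∈ densityMatrices d) (h₂ : χ₂ ∈ densityMatrices d) :
    ContinuousOn (fun ψ : M.AffineEstimator × ℝ => M.Phi ρ ε ε₀ χ₁ χ₂ ψ.1 ψ.2)
      (Set.univ ×ˢ Set.Ioi (0 : ℝ)) := by
  have hα : ∀ ψ ∈ (Set.univ : Set M.AffineEstimator) ×ˢ Set.Ioi (0 : ℝ), ψ.2 ≠ 0 :=
    fun ψ hψ => (Set.mem_Ioi.mp hψ.2).ne'
  unfold Phi
  refine ContinuousOn.add (by fun_prop) (continuousOn_snd.mul (continuousOn_finsetSum _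
    fun l _ => continuousOn_const.mul (ContinuousOn.add ?_ ?_)))
  · refine ContinuousOn.log ?_ fun ψ _ => (M.sum_exp_mul_prob_pos hd h₀ h₁ l _).ne'
    refine continuousOn_finsetSum _ fun k _ => ContinuousOn.mul (Real.continuous_exp.comp_continuousOn
      (ContinuousOn.div (by fun_prop) continuousOn_snd hα)) continuousOn_const
  · refine ContinuousOn.log ?_ fun ψ _ => (M.sum_exp_mul_prob_pos hd h₀ h₂ l _).ne'
    refine continuousOn_finsetSum _ fun k _ => ContinuousOn.mul (Real.continuous_exp.comp_continuousOn
      (ContinuousOn.div (by fun_prop) continuousOn_snd hα)) continuousOn_const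

theorem supInfPhi_eq_infSupPhi (hd : 0 < d) (h₀ : 0 ≤ ε₀) (hρ : ρ ∈ densityMatrices d) :
    M.supInfPhi ρ ε ε₀ = M.infSupPhi ρ ε ε₀ := by
  unfold supInfPhi infSupPhi
  have hD := convex_densityMatrices d
  have kD := isCompact_densityMatrices d
  have hY : Convex ℝ ((Set.univ : Set M.AffineEstimator) ×ˢ Set.Ioi (0 : ℝ)) :=
    convex_univ.prod (convex_Ioi 0)
  refine iSup_iInf_eq_iInf_iSup_of_concave_convex
    (X := densityMatrices d ×ˢ densityMatrices d)
    (Y := (Set.univ : Set M.AffineEstimator) ×ˢ Set.Ioi (0 : ℝ))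
    (f := fun χ ψ => M.Phi ρ ε ε₀ χ.1 χ.2 ψ.1 ψ.2) ⟨(ρ, ρ), hρ, hρ⟩ (kD.prod kD)
    ?_ ?_ (hD.prod hD) hY ?_ ?_
  · exact fun ψ _ => M.continuousOn_Phi_states hd h₀ ψ.1 ψ.2
  · exact fun ψ hψ => M.concaveOn_Phi hd h₀ ψ.1 hψ.2
  · exact fun χ hχ => M.continuousOn_Phi_estimators hd h₀ hχ.1 hχ.2
  · exact fun χ hχ => M.convexOn_Phi hd h₀ hχ.1 hχ.2

end MeasurementScheme


/-! ### Finiteness of the value and the lower bound -/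

namespace MeasurementScheme

variable {d : ℕ} (M : MeasurementScheme d) {ρ χ₁ χ₂ : Matrix (Fin d) (Fin d) ℂ} {ε ε₀ : ℝ}

theorem coe_le_supInfPhi {c : ℝ} (h₁ : χ₁ ∈ densityMatrices d) (h₂ : χ₂ ∈ densityMatrices d)
    (h : ∀ (φ : M.AffineEstimator) (α : ℝ), 0 < α → c ≤ M.Phi ρ ε ε₀ χ₁ χ₂ φ α) :
    (c : EReal) ≤ M.supInfPhi ρ ε ε₀ :=
  le_iSup₂_of_le (χ₁, χ₂) ⟨h₁, h₂⟩ <| le_iInf₂ fun ψ hψ =>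
    EReal.coe_le_coe_iff.mpr (h ψ.1 ψ.2 hψ.2)

theorem infSupPhi_le_coe {c α : ℝ} (φ : M.AffineEstimator) (hα : 0 < α)
    (h : ∀ χ₁ ∈ densityMatrices d, ∀ χ₂ ∈ densityMatrices d, M.Phi ρ ε ε₀ χ₁ χ₂ φ α ≤ c) :
    M.infSupPhi ρ ε ε₀ ≤ c :=
  iInf₂_le_of_le (φ, α) ⟨trivial, hα⟩ <| iSup₂_le fun χ hχ =>
    EReal.coe_le_coe_iff.mpr (h χ.1 hχ.1 χ.2 hχ.2)

/-- If the outcome distributions in the states `χ₁` and `χ₂` have Bhattacharyya coefficient at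
least `c` for every measurement setting, then `Φ(χ₁, χ₂; ·, ·)` is bounded below. -/
theorem le_Phi_of_overlap (hd : 0 < d) (h₀ : 0 ≤ ε₀) (h₁ : χ₁ ∈ densityMatrices d)
    (h₂ : χ₂ ∈ densityMatrices d) {c : ℝ} (hc : 0 < c) (r : M.AffineEstimator)
    (hr : ∀ l k, r l k ^ 2 ≤ M.prob ε₀ χ₁ l k * M.prob ε₀ χ₂ l k) (hsum : ∀ l, ∑ k, r l k = c)
    (φ : M.AffineEstimator) {α : ℝ} (hα : 0 < α) :
    expVal ρ χ₁ - expVal ρ χ₂ + 2 * α * (Real.log (2 / ε) + M.totalShots * Real.log c)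
      ≤ M.Phi ρ ε ε₀ χ₁ χ₂ φ α := by
  have hl : ∀ l, 2 * Real.log c ≤
      Real.log (∑ k, Real.exp (-(φ l k) / α) * M.prob ε₀ χ₁ l k)
        + Real.log (∑ k, Real.exp (φ l k / α) * M.prob ε₀ χ₂ l k) := fun l => by
    have h := two_mul_log_le_of_sq_le_mul (s := Finset.univ)
      (fun k _ => M.prob_nonneg h₀ h₁ l k) (fun k _ => M.prob_nonneg h₀ h₂ l k)
      (fun k _ => hr l k) (by rw [hsum]; exact hc) (M.sum_prob hd h₀ h₁ l)
      (M.sum_prob hd h₀ h₂ l) (fun k => φ l k / α)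
    rw [hsum] at h
    simpa only [neg_div] using h
  have hS : (M.totalShots : ℝ) * (2 * Real.log c) ≤ ∑ l, (M.R l : ℝ) *
      (Real.log (∑ k, Real.exp (-(φ l k) / α) * M.prob ε₀ χ₁ l k)
        + Real.log (∑ k, Real.exp (φ l k / α) * M.prob ε₀ χ₂ l k)) := by
    rw [totalShots, Nat.cast_sum, Finset.sum_mul]
    exact Finset.sum_le_sum fun l _ => mul_le_mul_of_nonneg_left (hl l) (Nat.cast_nonneg _)
  have := mul_le_mul_of_nonneg_left hS hα.le
  unfold Phi
  linarith

/-- The pair `(ρ, ρ)` is a witness: its two outcome distributions coincide, so their overlap is `1`.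
-/
theorem supInfPhi_nonneg (hd : 0 < d) (h₀ : 0 ≤ ε₀) (hε : 0 ≤ Real.log (2 / ε))
    (hρ : ρ ∈ densityMatrices d) : 0 ≤ M.supInfPhi ρ ε ε₀ := by
  refine M.coe_le_supInfPhi hρ hρ fun φ α hα => ?_
  have h := M.le_Phi_of_overlap (ρ := ρ) (ε := ε) hd h₀ hρ hρ one_pos (M.prob ε₀ ρ)
    (fun l k => (sq _).le) (M.sum_prob hd h₀ hρ) φ hα
  rw [Real.log_one, sub_self, zero_add, mul_zero, add_zero] at h
  exact h.trans' (by positivity)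

/-- At `φ = 0`, `α = 1` every logarithm is `log 1`. -/
theorem infSupPhi_le (hd : 0 < d) (h₀ : 0 ≤ ε₀) (hρ : ρ ∈ densityMatrices d) :
    M.infSupPhi ρ ε ε₀ ≤ ((1 + 2 * Real.log (2 / ε) : ℝ) : EReal) := by
  refine M.infSupPhi_le_coe 0 one_pos fun χ₁ h₁ χ₂ h₂ => ?_
  have := expVal_le_one hρ h₁
  have := expVal_nonneg hρ.1 h₂.1
  simp only [Phi, Pi.zero_apply, neg_zero, zero_div, Real.exp_zero, one_mul, mul_one,
    M.sum_prob hd h₀ h₁, M.sum_prob hd h₀ h₂, Real.log_one, add_zero, mul_zero,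
    Finset.sum_const_zero]
  linarith

theorem supInfPhi_eq_coe (hd : 0 < d) (h₀ : 0 ≤ ε₀) (hε : 0 ≤ Real.log (2 / ε))
    (hρ : ρ ∈ densityMatrices d) :
    M.supInfPhi ρ ε ε₀ = ((2 * M.minimaxRisk ρ ε ε₀ : ℝ) : EReal) := by
  have hbot : M.supInfPhi ρ ε ε₀ ≠ ⊥ :=
    ((EReal.bot_lt_zero).trans_le (M.supInfPhi_nonneg hd h₀ hε hρ)).ne'
  have htop : M.supInfPhi ρ ε ε₀ ≠ ⊤ := by
    rw [M.supInfPhi_eq_infSupPhi hd h₀ hρ]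
    exact ((M.infSupPhi_le hd h₀ hρ).trans_lt (EReal.coe_lt_top _)).ne
  rw [minimaxRisk, ← mul_assoc, mul_one_div_cancel two_ne_zero, one_mul,
    EReal.coe_toReal htop hbot]

theorem le_two_mul_minimaxRisk (hd : 0 < d) (h₀ : 0 ≤ ε₀) (hε : 0 ≤ Real.log (2 / ε))
    (hρ : ρ ∈ densityMatrices d) {c : ℝ} (h₁ : χ₁ ∈ densityMatrices d)
    (h₂ : χ₂ ∈ densityMatrices d)
    (h : ∀ (φ : M.AffineEstimator) (α : ℝ), 0 < α → c ≤ M.Phi ρ ε ε₀ χ₁ χ₂ φ α) :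
    c ≤ 2 * M.minimaxRisk ρ ε ε₀ := by
  rw [← EReal.coe_le_coe_iff, ← M.supInfPhi_eq_coe hd h₀ hε hρ]
  exact M.coe_le_supInfPhi h₁ h₂ h

theorem two_mul_minimaxRisk_le (hd : 0 < d) (h₀ : 0 ≤ ε₀) (hε : 0 ≤ Real.log (2 / ε))
    (hρ : ρ ∈ densityMatrices d) {c α : ℝ} (φ : M.AffineEstimator) (hα : 0 < α)
    (h : ∀ χ₁ ∈ densityMatrices d, ∀ χ₂ ∈ densityMatrices d, M.Phi ρ ε ε₀ χ₁ χ₂ φ α ≤ c) :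
    2 * M.minimaxRisk ρ ε ε₀ ≤ c := by
  rw [← EReal.coe_le_coe_iff, ← M.supInfPhi_eq_coe hd h₀ hε hρ,
    M.supInfPhi_eq_infSupPhi hd h₀ hρ]
  exact M.infSupPhi_le_coe φ hα h

/-- Without any measurement the risk is at least one half. -/
theorem half_le_minimaxRisk (hd : 2 ≤ d) (h₀ : 0 ≤ ε₀) (hε : 0 ≤ Real.log (2 / ε))
    (hρ : IsPureState ρ) (hR : M.totalShots = 0) : 1 / 2 ≤ M.minimaxRisk ρ ε ε₀ := by
  obtain ⟨σ, hσ, hρσ⟩ := hρ.exists_orthogonal hd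
  have hRl : ∀ l, M.R l = 0 := fun l => Finset.sum_eq_zero_iff.mp hR l (Finset.mem_univ l)
  have h := M.le_two_mul_minimaxRisk (by omega) h₀ hε hρ.1 (c := 1) hρ.1 hσ fun φ α hα => by
    simp only [Phi, hρ.expVal_self, hρσ, hRl, Nat.cast_zero, zero_mul, Finset.sum_const_zero]
    have : 0 ≤ 2 * α * Real.log (2 / ε) := by positivity
    linarith
  linarith

/-- Mixtures of the target state and an orthogonal state witness the lower bound on the risk. -/
theorem sqrt_one_sub_sq_le_two_mul_minimaxRisk (hd : 2 ≤ d) (h₀ : 0 ≤ ε₀)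
    (hε : 0 ≤ Real.log (2 / ε)) (hρ : IsPureState ρ) {γ : ℝ} (hγ : 0 < γ) (hγ' : γ ≤ 1)
    (hR : 0 ≤ Real.log (2 / ε) + M.totalShots * Real.log γ) :
    √(1 - γ ^ 2) ≤ 2 * M.minimaxRisk ρ ε ε₀ := by
  obtain ⟨σ, hσ, hρσ⟩ := hρ.exists_orthogonal hd
  have hd' : 0 < d := by omega
  set s := √(1 - γ ^ 2) with hs
  have hs0 : 0 ≤ s := Real.sqrt_nonneg _
  have hs2 : s ^ 2 = 1 - γ ^ 2 := Real.sq_sqrt (by nlinarith)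
  have hs1 : s ≤ 1 := by nlinarith
  have ha : 0 ≤ (1 + s) / 2 := by linarith
  have hb : 0 ≤ (1 - s) / 2 := by linarith
  have hab : (1 + s) / 2 + (1 - s) / 2 = 1 := by ring
  have hba : (1 - s) / 2 + (1 + s) / 2 = 1 := by ring
  have h₁ := convex_densityMatrices d hρ.1 hσ ha hb hab
  have h₂ := convex_densityMatrices d hρ.1 hσ hb ha hba
  refine M.le_two_mul_minimaxRisk hd' h₀ hε hρ.1 h₁ h₂ fun φ α hα => ?_
  -- With `P`, `Q` the outcome probabilities of `ρ`, `σ`, the product of the two mixed probabilities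
  -- equals `(γ/2)²(P + Q)² + s²PQ`. Dropping the last term leaves a perfect square whose root sums
  -- to `γ`, whatever the POVM.
  have h := M.le_Phi_of_overlap (ρ := ρ) (ε := ε) hd' h₀ h₁ h₂ hγ
    (fun l k => γ / 2 * (M.prob ε₀ ρ l k + M.prob ε₀ σ l k)) ?_ ?_ φ hα
  · refine le_trans ?_ h
    rw [expVal_smul_add_smul, expVal_smul_add_smul, hρ.expVal_self, hρσ]
    have := mul_nonneg (mul_nonneg zero_le_two hα.le) hR
    linarith
  · intro l k
    rw [M.prob_smul_add_smul _ _ hab, M.prob_smul_add_smul _ _ hba]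
    have hg : γ ^ 2 = 1 - s ^ 2 := by linarith
    have hsq : 0 ≤ s ^ 2 * (M.prob ε₀ ρ l k * M.prob ε₀ σ l k) :=
      mul_nonneg (sq_nonneg s)
        (mul_nonneg (M.prob_nonneg h₀ hρ.1 l k) (M.prob_nonneg h₀ hσ l k))
    rw [mul_pow, div_pow, hg]
    linarith
  · intro l
    rw [← Finset.mul_sum, Finset.sum_add_distrib, M.sum_prob hd' h₀ hρ.1, M.sum_prob hd' h₀ hσ]
    ring

end MeasurementScheme

/-! ### Optimality of measuring in the basis of the target -/

section TargetScheme

variable {d : ℕ} {ρ χ₁ χ₂ : Matrix (Fin d) (Fin d) ℂ} {ε ε₀ : ℝ}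

theorem targetScheme_totalShots (hρ : ρ ∈ densityMatrices d) (R : ℕ) :
    (targetScheme ρ hρ R).totalShots = R :=
  Fin.sum_univ_one _

theorem targetScheme_sum_exp_mul_prob (hρ : ρ ∈ densityMatrices d) (R : ℕ) (h₀ : 0 ≤ ε₀)
    {χ : Matrix (Fin d) (Fin d) ℂ} (hχ : χ ∈ densityMatrices d) (u : Fin 2 → ℝ) :
    ∑ k : Fin 2, Real.exp (u k) * (targetScheme ρ hρ R).prob ε₀ χ (0 : Fin 1) k
      = Real.exp (u 0) * ((expVal ρ χ + ε₀ / 2) / (1 + ε₀))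
        + Real.exp (u 1) * (1 - (expVal ρ χ + ε₀ / 2) / (1 + ε₀)) := by
  have h1 : (1 - (expVal ρ χ + ε₀ / 2) / (1 + ε₀)) = (expVal (1 - ρ) χ + ε₀ / 2) / (1 + ε₀) := by
    rw [expVal_sub_left, expVal_one_left hχ]
    have : 1 + ε₀ ≠ 0 := by positivity
    field_simp
    ring
  rw [h1]
  refine (Fin.sum_univ_two _).trans ?_
  simp [MeasurementScheme.prob, targetScheme]

theorem log_le_log_add_div_sub_one {γ z : ℝ} (hγ : 0 < γ) (hz : 0 < z) :
    Real.log z ≤ Real.log γ + (z / γ - 1) := by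
  have h := Real.log_le_sub_one_of_pos (div_pos hz hγ)
  rw [Real.log_div hz.ne' hγ.ne'] at h
  linarith

/-- The scalar inequality behind optimality of the measurement in the basis of the target. -/
theorem sub_add_log_add_log_le {γ s p q : ℝ} (hγ : 0 < γ) (hs : 0 < s) (hγs : γ ^ 2 + s ^ 2 = 1)
    (hp : p ≤ 1) (hq : 0 ≤ q) :
    p - q + γ ^ 2 / (2 * s) *
      (Real.log ((1 - s) / γ * p + (1 + s) / γ * (1 - p))
        + Real.log ((1 + s) / γ * q + (1 - s) / γ * (1 - q)) - 2 * Real.log γ) ≤ s := by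
  have hs1 : s < 1 := by nlinarith
  have hz₁ : 0 < (1 - s) / γ * p + (1 + s) / γ * (1 - p) := by
    have : (1 - s) / γ * p + (1 + s) / γ * (1 - p) = ((1 - s) + 2 * s * (1 - p)) / γ := by ring
    rw [this]
    have : 0 ≤ s * (1 - p) := mul_nonneg hs.le (sub_nonneg.mpr hp)
    exact div_pos (by linarith) hγ
  have hz₂ : 0 < (1 + s) / γ * q + (1 - s) / γ * (1 - q) := by
    have : (1 + s) / γ * q + (1 - s) / γ * (1 - q) = ((1 - s) + 2 * s * q) / γ := by ring
    rw [this]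
    have : 0 ≤ s * q := mul_nonneg hs.le hq
    exact div_pos (by linarith) hγ
  have h := add_le_add (log_le_log_add_div_sub_one hγ hz₁) (log_le_log_add_div_sub_one hγ hz₂)
  have hc : 0 ≤ γ ^ 2 / (2 * s) := by positivity
  -- The prefactor `γ²/(2s)` is chosen so that the linear terms from the tangent bounds cancel `p -
  -- q` exactly.
  calc _ ≤ p - q + γ ^ 2 / (2 * s) * ((2 - 2 * s * (p - q)) / γ ^ 2 - 2) := by
        refine add_le_add_right (mul_le_mul_of_nonneg_left ?_ hc) _
        refine (sub_le_sub_right h _).trans_eq ?_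
        field_simp
        ring
    _ = (1 - γ ^ 2) / s := by
        field_simp
        ring
    _ = s := by
        rw [← hγs]
        field_simp
        ring

theorem two_mul_minimaxRisk_targetScheme_le (hd : 0 < d) (hρ : ρ ∈ densityMatrices d) {R : ℕ}
    (hR : 0 < R) (h₀ : 0 ≤ ε₀) (hε : 0 ≤ Real.log (2 / ε)) {γ : ℝ} (hγ : 0 < γ) (hγ' : γ < 1)
    (hγR : Real.log (2 / ε) = -(R * Real.log γ)) :
    2 * (targetScheme ρ hρ R).minimaxRisk ρ ε ε₀ ≤ (1 + ε₀) * √(1 - γ ^ 2) := by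
  have hpos : 0 < 1 - γ ^ 2 := by nlinarith
  set s := √(1 - γ ^ 2) with hs
  have hs0 : 0 < s := Real.sqrt_pos.mpr hpos
  have hγs : γ ^ 2 + s ^ 2 = 1 := by rw [hs, Real.sq_sqrt hpos.le]; ring
  have hs1 : s < 1 := by nlinarith
  have hR' : (0 : ℝ) < R := by exact_mod_cast hR
  have hε₁ : 0 < 1 + ε₀ := by linarith
  -- This makes `αR` equal to `1 + ε₀` times the prefactor in `sub_add_log_add_log_le`. The factor
  -- `1 + ε₀` appears because the noise shrinks fidelity differences by it.
  set α : ℝ := (1 + ε₀) * (γ ^ 2 / (2 * s)) / R with hα_def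
  have hα : 0 < α := by positivity
  -- `t² = (1 + s)/(1 - s)`, so `log t` is half the noiseless log-likelihood ratio of the extremal
  -- mixtures, the equality case of Cauchy-Schwarz.
  set t := (1 + s) / γ with ht
  have ht0 : 0 < t := by positivity
  have htinv : t⁻¹ = (1 - s) / γ := by
    rw [ht, inv_div, div_eq_div_iff (by positivity) hγ.ne']
    linarith
  refine (targetScheme ρ hρ R).two_mul_minimaxRisk_le hd h₀ hε hρ
    (fun _ => ![α * Real.log t, -(α * Real.log t)]) hα fun χ₁ h₁ χ₂ h₂ => ?_
  have hexp : Real.exp (α * Real.log t / α) = (1 + s) / γ := by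
    rw [mul_div_cancel_left₀ _ hα.ne', Real.exp_log ht0]
  have hexp' : Real.exp (-(α * Real.log t) / α) = (1 - s) / γ := by
    rw [neg_div, mul_div_cancel_left₀ _ hα.ne', Real.exp_neg, Real.exp_log ht0, htinv]
  have hbound : ∀ χ ∈ densityMatrices d, 0 ≤ (expVal ρ χ + ε₀ / 2) / (1 + ε₀) ∧
      (expVal ρ χ + ε₀ / 2) / (1 + ε₀) ≤ 1 := fun χ hχ => by
    have h1 := expVal_nonneg hρ.1 hχ.1
    have h2 := expVal_le_one hρ hχ
    exact ⟨by positivity, (div_le_one hε₁).mpr (by linarith)⟩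
  have hPhi : (targetScheme ρ hρ R).Phi ρ ε ε₀ χ₁ χ₂
      (fun _ => ![α * Real.log t, -(α * Real.log t)]) α = expVal ρ χ₁ - expVal ρ χ₂
        + 2 * α * Real.log (2 / ε) + α * (R * (
        Real.log ((1 - s) / γ * ((expVal ρ χ₁ + ε₀ / 2) / (1 + ε₀))
          + (1 + s) / γ * (1 - (expVal ρ χ₁ + ε₀ / 2) / (1 + ε₀)))
        + Real.log ((1 + s) / γ * ((expVal ρ χ₂ + ε₀ / 2) / (1 + ε₀))
          + (1 - s) / γ * (1 - (expVal ρ χ₂ + ε₀ / 2) / (1 + ε₀))))) := by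
    have e₁ := targetScheme_sum_exp_mul_prob hρ R h₀ h₁
      fun k => -(![α * Real.log t, -(α * Real.log t)] k) / α
    have e₂ := targetScheme_sum_exp_mul_prob hρ R h₀ h₂
      fun k => ![α * Real.log t, -(α * Real.log t)] k / α
    simp only [Matrix.cons_val_zero, Matrix.cons_val_one, neg_neg, hexp, hexp'] at e₁ e₂
    rw [← e₁, ← e₂]
    exact congrArg (fun z => expVal ρ χ₁ - expVal ρ χ₂ + 2 * α * Real.log (2 / ε) + α * z)
      (Fin.sum_univ_one _)
  rw [hPhi]
  have key := sub_add_log_add_log_le hγ hs0 hγs (hbound χ₁ h₁).2 (hbound χ₂ h₂).1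
  refine le_trans (le_of_eq ?_) (mul_le_mul_of_nonneg_left key hε₁.le)
  have hdiff : expVal ρ χ₁ - expVal ρ χ₂ = (1 + ε₀) *
      ((expVal ρ χ₁ + ε₀ / 2) / (1 + ε₀) - (expVal ρ χ₂ + ε₀ / 2) / (1 + ε₀)) := by
    field_simp
    ring
  have hαR : (1 + ε₀) * (γ ^ 2 / (2 * s)) = α * R := by
    rw [hα_def, div_mul_cancel₀ _ hR'.ne']
  rw [hγR, hdiff, mul_add (1 + ε₀), ← mul_assoc (1 + ε₀) (γ ^ 2 / (2 * s)), hαR]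
  ring

end TargetScheme

/-! ### Inverting the risk formula and its small-risk asymptotics -/

section SampleComplexity

variable {ε : ℝ}

theorem log_rpow_inv_natCast {x : ℝ} (hx : 0 < x) {R : ℕ} (hR : 0 < R) :
    R * Real.log (x ^ (1 / (R : ℝ))) = Real.log x := by
  have hR' : (R : ℝ) ≠ 0 := by exact_mod_cast hR.ne'
  rw [Real.log_rpow hx]
  field_simp

theorem rpow_two_div_natCast {x : ℝ} (hx : 0 < x) (R : ℕ) :
    x ^ (2 / (R : ℝ)) = (x ^ (1 / (R : ℝ))) ^ 2 := by
  rw [← Real.rpow_natCast, ← Real.rpow_mul hx.le]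
  congr 1
  push_cast
  ring

theorem log_two_div_eq_neg (ε : ℝ) : Real.log (2 / ε) = -Real.log (ε / 2) := by
  rw [← Real.log_inv, inv_div]

/-- The optimal risk for `R` shots is at most `r` precisely when `R` reaches the sample
complexity. -/
theorem half_sqrt_le_iff {r : ℝ} (hr : r ∈ Set.Ioo (0 : ℝ) 0.5) (hε : 0 < ε)
    {R : ℕ} (hR : 0 < R) :
    (1 / 2) * √(1 - (ε / 2) ^ (2 / (R : ℝ))) ≤ r ↔
      2 * Real.log (2 / ε) / |Real.log (1 - 4 * r ^ 2)| ≤ (R : ℝ) := by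
  obtain ⟨hr0, hr1⟩ := hr
  have hR' : (0 : ℝ) < R := by exact_mod_cast hR
  have hx : 0 < ε / 2 := by positivity
  have h4 : 0 < 1 - 4 * r ^ 2 := by norm_num at hr1; nlinarith
  have hlog : Real.log (1 - 4 * r ^ 2) < 0 := Real.log_neg h4 (by nlinarith)
  rw [abs_of_neg hlog, div_le_iff₀ (neg_pos.mpr hlog), log_two_div_eq_neg]
  have h1 : (1 / 2) * √(1 - (ε / 2) ^ (2 / (R : ℝ))) ≤ r ↔
      1 - 4 * r ^ 2 ≤ (ε / 2) ^ (2 / (R : ℝ)) := by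
    rw [show (1 / 2) * √(1 - (ε / 2) ^ (2 / (R : ℝ))) ≤ r ↔
      √(1 - (ε / 2) ^ (2 / (R : ℝ))) ≤ 2 * r by constructor <;> intro h <;> linarith,
      Real.sqrt_le_left (by linarith)]
    constructor <;> intro h <;> linarith
  rw [h1, ← Real.log_le_log_iff h4 (Real.rpow_pos_of_pos hx _), Real.log_rpow hx,
    div_mul_eq_mul_div, le_div_iff₀ hR']
  constructor <;> intro h <;> linarith

open Filter Asymptotics in
-- The derivative of `log (1 - x)` at `0` gives `log (1 - x) ~ -x`; substitute `x = 4r²`.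
theorem isEquivalent_sampleComplexity (c : ℝ) :
    IsEquivalent (nhdsWithin (0 : ℝ) (Set.Ioi 0))
      (fun r : ℝ => 2 * c / |Real.log (1 - 4 * r ^ 2)|) (fun r : ℝ => c / (2 * r ^ 2)) := by
  have hlog : IsEquivalent (nhds (0 : ℝ)) (fun x : ℝ => Real.log (1 - x)) fun x => -x := by
    have h : HasDerivAt (fun x : ℝ => Real.log (1 - x)) (-1) 0 := by
      have := ((hasDerivAt_id (0 : ℝ)).const_sub 1).log (by simp)
      simpa using this
    have h' := h.isLittleO
    simp only [sub_zero, Real.log_one, smul_eq_mul, mul_neg, mul_one] at h'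
    exact h'.trans_isBigO (isBigO_refl _ _).neg_right
  have hT : Tendsto (fun r : ℝ => 4 * r ^ 2) (nhdsWithin 0 (Set.Ioi 0)) (nhds 0) := by
    have : Continuous fun r : ℝ => 4 * r ^ 2 := by fun_prop
    simpa using (this.tendsto 0).mono_left nhdsWithin_le_nhds
  have hcomp := (hlog.comp_tendsto hT).neg
  have heq : (fun r : ℝ => |Real.log (1 - 4 * r ^ 2)|) =ᶠ[nhdsWithin 0 (Set.Ioi 0)]
      fun r => -Real.log (1 - 4 * r ^ 2) := by
    have : ∀ᶠ r : ℝ in nhdsWithin 0 (Set.Ioi 0), 4 * r ^ 2 < 1 := hT.eventually_lt_const one_pos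
    filter_upwards [this] with r hr
    exact abs_of_nonpos (Real.log_nonpos (by linarith) (by nlinarith))
  have habs : IsEquivalent (nhdsWithin (0 : ℝ) (Set.Ioi 0))
      (fun r : ℝ => |Real.log (1 - 4 * r ^ 2)|) fun r => 4 * r ^ 2 := by
    refine IsEquivalent.congr_left ?_ heq.symm
    simpa [Function.comp_def] using hcomp
  have h := (IsEquivalent.refl (u := fun _ : ℝ => 2 * c)).div habs
  refine h.congr_right (Eventually.of_forall fun r => ?_)
  simp only [Pi.div_apply]
  rw [show 4 * r ^ 2 = 2 * (2 * r ^ 2) by ring, mul_div_mul_left _ _ two_ne_zero]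

end SampleComplexity

end QuantumMinimax


theorem theorem1 (d : ℕ) (hd : 2 ≤ d) (ρ : Matrix (Fin d) (Fin d) ℂ)
    (hρ : QuantumMinimax.IsPureState ρ) (ε : ℝ) (hε : 1 - ε ∈ Set.Ioo (0.75 : ℝ) 1) :
    -- the saddle-point value of `Φ` is well defined, and the risk is half of it
    (∀ (M : QuantumMinimax.MeasurementScheme d) (ε₀ : ℝ), 0 ≤ ε₀ →
      M.supInfPhi ρ ε ε₀ = ((2 * M.minimaxRisk ρ ε ε₀ : ℝ) : EReal) ∧
      M.infSupPhi ρ ε ε₀ = ((2 * M.minimaxRisk ρ ε ε₀ : ℝ) : EReal)) ∧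
    -- lower bound on the risk, for any measurement scheme
    (∀ (M : QuantumMinimax.MeasurementScheme d) (ε₀ : ℝ), 0 ≤ ε₀ → 0 < M.totalShots →
      (1 / 2) * √(1 - (ε / 2) ^ (2 / (M.totalShots : ℝ))) ≤ M.minimaxRisk ρ ε ε₀) ∧
    -- the bound is attained by `R` repetitions of `{ρ, 1 - ρ}`
    (∀ R : ℕ, 0 < R →
      (QuantumMinimax.targetScheme ρ hρ.1 R).minimaxRisk ρ ε 0
        = (1 / 2) * √(1 - (ε / 2) ^ (2 / (R : ℝ)))) ∧
    -- and for `ε₀ > 0` it is attained up to the factor `1 + ε₀`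
    (∀ (R : ℕ) (ε₀ : ℝ), 0 < R → 0 ≤ ε₀ →
      (QuantumMinimax.targetScheme ρ hρ.1 R).minimaxRisk ρ ε ε₀
        ≤ (1 + ε₀) * ((1 / 2) * √(1 - (ε / 2) ^ (2 / (R : ℝ))))) ∧
    -- sample complexity: shots that are necessary, for any measurement scheme
    (∀ r ∈ Set.Ioo (0 : ℝ) 0.5, ∀ (M : QuantumMinimax.MeasurementScheme d) (ε₀ : ℝ), 0 ≤ ε₀ →
      M.minimaxRisk ρ ε ε₀ ≤ r →
      2 * Real.log (2 / ε) / |Real.log (1 - 4 * r ^ 2)| ≤ (M.totalShots : ℝ)) ∧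
    -- and the same number of shots of `{ρ, 1 - ρ}` is sufficient
    (∀ r ∈ Set.Ioo (0 : ℝ) 0.5, ∀ R : ℕ,
      2 * Real.log (2 / ε) / |Real.log (1 - 4 * r ^ 2)| ≤ (R : ℝ) →
      (QuantumMinimax.targetScheme ρ hρ.1 R).minimaxRisk ρ ε 0 ≤ r) ∧
    -- behaviour of the sample complexity for small risk
    Asymptotics.IsEquivalent (nhdsWithin (0 : ℝ) (Set.Ioi 0))
      (fun r : ℝ => 2 * Real.log (2 / ε) / |Real.log (1 - 4 * r ^ 2)|)
      (fun r : ℝ => Real.log (2 / ε) / (2 * r ^ 2)) := by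
  obtain ⟨hε1, hε2⟩ := hε
  have hε0 : 0 < ε := by linarith
  have hε3 : ε < 1 := by norm_num at hε1; linarith
  have hx : 0 < ε / 2 := by positivity
  have hL : 0 ≤ Real.log (2 / ε) := Real.log_nonneg ((one_le_div hε0).mpr (by linarith))
  have hd' : 0 < d := by omega
  -- The overlap `γ = (ε/2)^(1/R)` is the one for which `R log γ` cancels `log (2/ε)`.
  have hγ : ∀ R : ℕ, 0 < (ε / 2) ^ (1 / (R : ℝ)) := fun R => Real.rpow_pos_of_pos hx _
  have hγ1 : ∀ R : ℕ, 0 < R → (ε / 2) ^ (1 / (R : ℝ)) < 1 := fun R hR =>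
    Real.rpow_lt_one hx.le (by linarith) (by positivity)
  have hγR : ∀ R : ℕ, 0 < R →
      Real.log (2 / ε) = -(R * Real.log ((ε / 2) ^ (1 / (R : ℝ)))) := fun R hR => by
    rw [QuantumMinimax.log_rpow_inv_natCast hx hR, QuantumMinimax.log_two_div_eq_neg]
  have lower : ∀ (M : QuantumMinimax.MeasurementScheme d) (ε₀ : ℝ), 0 ≤ ε₀ → 0 < M.totalShots →
      (1 / 2) * √(1 - (ε / 2) ^ (2 / (M.totalShots : ℝ))) ≤ M.minimaxRisk ρ ε ε₀ := by
    intro M ε₀ h₀ hR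
    have h := M.sqrt_one_sub_sq_le_two_mul_minimaxRisk hd h₀ hL hρ (hγ M.totalShots)
      (hγ1 _ hR).le (by linarith [hγR _ hR])
    rw [← QuantumMinimax.rpow_two_div_natCast hx] at h
    linarith
  have upper : ∀ (R : ℕ) (ε₀ : ℝ), 0 < R → 0 ≤ ε₀ →
      (QuantumMinimax.targetScheme ρ hρ.1 R).minimaxRisk ρ ε ε₀
        ≤ (1 + ε₀) * ((1 / 2) * √(1 - (ε / 2) ^ (2 / (R : ℝ)))) := by
    intro R ε₀ hR h₀
    have h := QuantumMinimax.two_mul_minimaxRisk_targetScheme_le hd' hρ.1 hR h₀ hL (hγ R)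
      (hγ1 R hR) (hγR R hR)
    rw [← QuantumMinimax.rpow_two_div_natCast hx] at h
    linarith
  have attained : ∀ R : ℕ, 0 < R →
      (QuantumMinimax.targetScheme ρ hρ.1 R).minimaxRisk ρ ε 0
        = (1 / 2) * √(1 - (ε / 2) ^ (2 / (R : ℝ))) := by
    intro R hR
    have hT := QuantumMinimax.targetScheme_totalShots hρ.1 R
    refine le_antisymm (by simpa using upper R 0 hR le_rfl) ?_
    simpa only [hT] using lower (QuantumMinimax.targetScheme ρ hρ.1 R) 0 le_rfl (hT ▸ hR)
  refine ⟨fun M ε₀ h₀ => ?_, lower, attained, upper, fun r hr M ε₀ h₀ hM => ?_,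
    fun r hr R hR => ?_, QuantumMinimax.isEquivalent_sampleComplexity _⟩
  · have h := M.supInfPhi_eq_coe hd' h₀ hL hρ.1
    exact ⟨h, (M.supInfPhi_eq_infSupPhi hd' h₀ hρ.1).symm.trans h⟩
  · rcases Nat.eq_zero_or_pos M.totalShots with hR | hR
    -- With no shots the lower bound is unavailable, but the risk is then at least `1/2 > r`.
    · have h := M.half_le_minimaxRisk hd h₀ hL hρ hR
      have hr1 := hr.2
      norm_num at hr1
      linarith
    · exact (QuantumMinimax.half_sqrt_le_iff hr hε0 hR).mp
        ((lower M ε₀ h₀ hR).trans hM)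
  -- The required number of shots is strictly positive, so `R = 0` cannot occur.
  · have hR0 : 0 < R := by
      have hlog : Real.log (1 - 4 * r ^ 2) ≠ 0 := by
        obtain ⟨hr0, hr1⟩ := hr
        norm_num at hr1
        exact (Real.log_neg (by nlinarith) (by nlinarith)).ne
      have hL' : 0 < Real.log (2 / ε) := Real.log_pos ((one_lt_div hε0).mpr (by linarith))
      have : (0 : ℝ) < R := hR.trans_lt' (by positivity)
      exact_mod_cast this
    rw [attained R hR0]
    exact (QuantumMinimax.half_sqrt_le_iff hr hε0 hR0).mpr hR
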